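/- An instance $\mathcal I$ of the stable matching problem with cardinal preferences consists of $n$ men, $n$ women, and two $n\times n$ matrices $U,V$ of non-negative rational numbers, where $U(m,w)$ is the value of man $m$ for woman $w$ and $V(m,w)$ is the value of woman $w$ for man $m$. A fractional matching is a matrix $\mu$ of weights $\mu(m,w)\ge 0$ with $\sum_{w}\mu(m,w)\le 1$ for every man $m$ and $\sum_{m}\mu(m,w)\le 1$ for every woman $w$. It is complete if all of these sums equal $1$, and integral if all weights lie in $\{0,1\}$. Put $u_m(\mu)=\sum_{w}U(m,w)\mu(m,w)$, $v_w(\mu)=\sum_{m}V(m,w)\mu(m,w)$ and $\mathcal W(\mu)=\sum_m u_m(\mu)+\sum_w v_w(\mu)$. The matching $\mu$ is stable if there is no pair $(m,w)$ with $u_m(\mu)<U(m,w)$ and $v_w(\mu)<V(m,w)$. An optimal matching $\mu^{\mathrm{opt}}$ is a fractional matching that maximizes $\mathcal W$ over all fractional matchings. **Theorem.** There is an algorithm which, given an instance $\mathcal I$ whose valuations are written in binary as numerators and denominators, runs in time polynomial in the bit length of the input and computes a complete, integral, stable matching $\mu$ with the following two properties, where $\mu^{\mathrm{opt}}$ is any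 optimal matching for $\mathcal I$. 1. If all entries of $U$ and $V$ lie in $\{0,1,\alpha\}$ for some $\alpha>1$, then $\mathcal W(\mu)\ge\min\{\tfrac12,\tfrac1\alpha\}\,\mathcal W(\mu^{\mathrm{opt}})$. 2. If not all valuations are zero, then $\mathcal W(\mu)\ge\left(1+\sigma_{\max}/\sigma_{\min}\right)^{-1}\mathcal W(\mu^{\mathrm{opt}})$, where $\sigma_{\max}$ and $\sigma_{\min}$ are the largest and the smallest non-zero valuation (entry of $U$ or $V$) in $\mathcal I$. -/

import Mathlib

/-! ### Stable matching with cardinal preferences -/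

/-- An instance of the Stable Matching problem with Cardinal preferences with `n` men and `n`
women: `U m w` is the value man `m` derives from woman `w`, and `V m w` is the value woman `w`
derives from man `m`; all valuations are non-negative rationals. -/
structure SMC (n : ℕ) where
  U : Fin n → Fin n → ℚ
  V : Fin n → Fin n → ℚ
  U_nonneg : ∀ m w, 0 ≤ U m w
  V_nonneg : ∀ m w, 0 ≤ V m w

/-- A fractional matching: non-negative weights with all row and column sums at most one. -/
structure IsFractionalMatching {n : ℕ} (μ : Fin n → Fin n → ℝ) : Prop where
  nonneg : ∀ m w, 0 ≤ μ m w
  man_le : ∀ m, ∑ w, μ m w ≤ 1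
  woman_le : ∀ w, ∑ m, μ m w ≤ 1

/-- Completeness: every man and every woman is fully matched. -/
def IsCompleteMatching {n : ℕ} (μ : Fin n → Fin n → ℝ) : Prop :=
  (∀ m, ∑ w, μ m w = 1) ∧ (∀ w, ∑ m, μ m w = 1)

/-- Integrality: all weights are `0` or `1`. -/
def IsIntegralMatching {n : ℕ} (μ : Fin n → Fin n → ℝ) : Prop :=
  ∀ m w, μ m w = 0 ∨ μ m w = 1

namespace SMC

variable {n : ℕ} (I : SMC n)

/-- The utility of man `m` in `μ`. -/
noncomputable def manUtility (μ : Fin n → Fin n → ℝ) (m : Fin n) : ℝ :=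
  ∑ w, (I.U m w : ℝ) * μ m w

/-- The utility of woman `w` in `μ`. -/
noncomputable def womanUtility (μ : Fin n → Fin n → ℝ) (w : Fin n) : ℝ :=
  ∑ m, (I.V m w : ℝ) * μ m w

/-- `(m, w)` is a blocking pair for `μ`. -/
def IsBlockingPair (μ : Fin n → Fin n → ℝ) (m w : Fin n) : Prop :=
  I.manUtility μ m < I.U m w ∧ I.womanUtility μ w < I.V m w

/-- `μ` has no blocking pair. -/
def IsStable (μ : Fin n → Fin n → ℝ) : Prop :=
  ∀ m w, ¬ I.IsBlockingPair μ m w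

/-- The social welfare of `μ`. -/
noncomputable def welfare (μ : Fin n → Fin n → ℝ) : ℝ :=
  ∑ m, I.manUtility μ m + ∑ w, I.womanUtility μ w

/-- `μ` has the highest social welfare among all fractional matchings. -/
def IsOptimal (μ : Fin n → Fin n → ℝ) : Prop :=
  IsFractionalMatching μ ∧ ∀ ν, IsFractionalMatching ν → I.welfare ν ≤ I.welfare μ

/-- All valuations lie in `{0, 1, α}`, where `α > 1`. -/
def IsTernary (α : ℚ) : Prop :=
  1 < α ∧ ∀ m w, I.U m w ∈ ({0, 1, α} : Set ℚ) ∧ I.V m w ∈ ({0, 1, α} : Set ℚ)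

/-- The non-zero valuations that occur in the instance. -/
def nonzeroValuations : Set ℚ :=
  {x | x ≠ 0 ∧ ∃ m w, x = I.U m w ∨ x = I.V m w}

/-- The instance as a list of integers: `n`, followed, for the pairs `(m, w)` in lexicographic
order, by the numerators and denominators (in lowest terms) of `U m w` and `V m w`. -/
def encode : List ℤ :=
  (n : ℤ) :: (List.finRange n).flatMap fun m => (List.finRange n).flatMap fun w =>
    [(I.U m w).num, ((I.U m w).den : ℤ), (I.V m w).num, ((I.V m w).den : ℤ)]

end SMC

/-! ### Random access machines with logarithmic cost

The memory is a family of arrays of integers. A program names its arrays statically, so it uses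
only finitely many of them, and addresses the cells of an array dynamically. Every operation is
charged the bit lengths of the integers (data and addresses) that it handles, so that
polynomial time means polynomial time in the bit model, as on a Turing machine. -/

namespace RAM

/-- The length of the binary representation of an integer, including a sign bit. -/
def bitLength (z : ℤ) : ℕ := z.natAbs.size + 1

/-- The number of bits of a list of integers written in binary. -/
def inputSize (x : List ℤ) : ℕ := (x.map bitLength).sum

/-- `s a k` is the content of cell `k` of array `a`. -/
abbrev Store := ℕ → ℤ → ℤ

/-- The binary operations. -/
inductive Op where
  | add | sub | mul | div | lt | eq

/-- The values of the operations; comparisons return `1` for true and `0` for false. -/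
def Op.val : Op → ℤ → ℤ → ℤ
  | .add, x, y => x + y
  | .sub, x, y => x - y
  | .mul, x, y => x * y
  | .div, x, y => x / y
  | .lt, x, y => if x < y then 1 else 0
  | .eq, x, y => if x = y then 1 else 0

/-- Expressions: integer constants, cells of array `a` with a computed address, and binary
operations. -/
inductive Expr where
  | const (c : ℤ)
  | read (a : ℕ) (k : Expr)
  | bin (o : Op) (x y : Expr)

/-- The value of an expression. -/
def Expr.val (s : Store) : Expr → ℤ
  | .const c => c
  | .read a k => s a (k.val s)
  | .bin o x y => o.val (x.val s) (y.val s)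

/-- The cost of evaluating an expression: the total bit length of the values of all its
subexpressions, the computed addresses among them. -/
def Expr.cost (s : Store) : Expr → ℕ
  | .const c => bitLength c
  | .read a k => k.cost s + bitLength (s a (k.val s))
  | .bin o x y => x.cost s + y.cost s + bitLength (o.val (x.val s) (y.val s))

/-- Programs: `assign a k v` writes `v` into cell `k` of array `a`; `cond` and `loop` (a while
loop) test whether the value of their expression is non-zero. -/
inductive Prog where
  | skip
  | assign (a : ℕ) (k v : Expr)
  | seq (p q : Prog)
  | cond (e : Expr) (p q : Prog)
  | loop (e : Expr) (p : Prog)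

/-- `Exec p s s' t`: the program `p`, started in the store `s`, halts in the store `s'` after
time `t`. -/
inductive Exec : Prog → Store → Store → ℕ → Prop where
  | skip (s : Store) : Exec .skip s s 1
  | assign (a : ℕ) (k v : Expr) (s : Store) :
      Exec (.assign a k v) s
        (Function.update s a (Function.update (s a) (k.val s) (v.val s)))
        (k.cost s + v.cost s + 1)
  | seq {p q : Prog} {s s' s'' : Store} {t t' : ℕ} :
      Exec p s s' t → Exec q s' s'' t' → Exec (.seq p q) s s'' (t + t')
  | cond_true {e : Expr} {p q : Prog} {s s' : Store} {t : ℕ} :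
      e.val s ≠ 0 → Exec p s s' t → Exec (.cond e p q) s s' (e.cost s + 1 + t)
  | cond_false {e : Expr} {p q : Prog} {s s' : Store} {t : ℕ} :
      e.val s = 0 → Exec q s s' t → Exec (.cond e p q) s s' (e.cost s + 1 + t)
  | loop_true {e : Expr} {p : Prog} {s s' s'' : Store} {t t' : ℕ} :
      e.val s ≠ 0 → Exec p s s' t → Exec (.loop e p) s' s'' t' →
      Exec (.loop e p) s s'' (e.cost s + 1 + t + t')
  | loop_false {e : Expr} {p : Prog} {s : Store} :
      e.val s = 0 → Exec (.loop e p) s s (e.cost s + 1)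

/-- The initial store: the input stands in the cells `0, 1, 2, …` of array `0`, and every other
cell of the memory is zero. -/
def initial (x : List ℤ) : Store := fun a k =>
  if a = 0 ∧ 0 ≤ k then x.getD k.toNat 0 else 0

/-- The `n × n` matrix that stands, row by row, in the cells `0, …, n * n - 1` of array `1`. -/
def outputMatrix (n : ℕ) (s : Store) : Fin n → Fin n → ℝ := fun i j =>
  (s 1 ((i : ℤ) * (n : ℤ) + (j : ℤ)) : ℝ)

end RAM

/-! A pair can block only if both of its values are positive. So an edge worth `x` to an agent and
`y` to the partner is ranked by `key x y`: lexicographically, first by `x` (replaced by `0` when `y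
= 0`), then by the total `x + y`. Deferred acceptance on these ranks yields a permutation `σ` with
`IsKeyStable`: every edge ranks, at one of its ends, no higher than the edge of `σ` there.

Stability for the true values follows (`IsKeyStable.isStable`), because on a would-be blocking pair
the first key components are the values themselves. Replacing `x` by `0` when `y = 0` lets totals
decide between edges that cannot block.

Welfare is bounded by linear programming duality. If key domination at an end forces the total of an
edge to be at most `c / 2` times the total of the edge of `σ` there (`add_le_of_key_le` with `c = 1
+ b / a`, `add_le_of_key_le_of_ternary` with `c = max 2 α`), then giving each agent `c / 2` times
the total of its edge in `σ` is a feasible dual solution. Each edge of `σ` is charged from both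
ends, so the dual value is `c` times the welfare of `σ`, and this bounds every fractional matching
(`welfare_le_of_dominates`).

For polynomial time, the main loop makes at most `n ^ 2 + 2 * n` iterations, by a potential. Stored
numbers are either input numbers or agent numbers and counters, so cells stay short; the products
needed to compare rationals occur only inside expressions. A time polynomial is then read off the
syntax of the program (`Prog.bound`, `Runs`), and `Rep` links stores to abstract states satisfying
`Inv`. -/

/-! ### Deferred acceptance -/

namespace DeferredAcceptance

variable {n : ℕ} {α : Type*} [LinearOrder α]

/-- The invariant of deferred acceptance, where `p m w` ranks the women for man `m` and `q m w`
ranks the men for woman `w`. The men with index below `i` have entered, `cur` is the man who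
proposes next, `h w` is the man that woman `w` holds, and `R` consists of the rejections. -/
structure Inv (p q : Fin n → Fin n → α) (i : ℕ) (cur : Option (Fin n))
    (h : Fin n → Option (Fin n)) (R : Finset (Fin n × Fin n)) : Prop where
  inj : ∀ m w w', h w = some m → h w' = some m → w = w'
  top : ∀ m w, h w = some m → (m, w) ∉ R ∧ ∀ w', (m, w') ∉ R → p m w' ≤ p m w
  rej : ∀ m w, (m, w) ∈ R → ∃ m', h w = some m' ∧ q m w ≤ q m' w
  free : ∀ m, (∀ w, h w ≠ some m) ↔ (cur = some m ∨ i ≤ m)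
  cur_lt : ∀ m, cur = some m → (m : ℕ) < i

variable {p q : Fin n → Fin n → α} {i : ℕ} {cur : Option (Fin n)} {h : Fin n → Option (Fin n)}
  {R : Finset (Fin n × Fin n)}

theorem inv_initial (p q : Fin n → Fin n → α) : Inv p q 0 none (fun _ => none) ∅ where
  inj := by simp
  top := by simp
  rej := by simp
  free := by simp
  cur_lt := by simp

theorem Inv.enter (H : Inv p q i none h R) (hi : i < n) :
    Inv p q (i + 1) (some ⟨i, hi⟩) h R where
  inj := H.inj
  top := H.top
  rej := H.rej
  free m := by
    rw [H.free m]
    simp only [reduceCtorEq, false_or, Option.some.injEq, Fin.ext_iff]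
    omega
  cur_lt m hm := by
    obtain rfl := Option.some.inj hm
    simp

/-- Pigeonhole: had every woman rejected the proposer, all `n` women would hold distinct men, hence
all men, including the proposer, who is free. -/
theorem Inv.exists_not_mem {m : Fin n} (H : Inv p q i (some m) h R) : ∃ w, (m, w) ∉ R := by
  by_contra! hR
  choose f hf _ using fun w => H.rej m w (hR w)
  have hinj : Function.Injective f := fun w w' e => H.inj _ _ _ (hf w) (e ▸ hf w')
  obtain ⟨w, hw⟩ := Finite.surjective_of_injective hinj m
  exact (H.free m).2 (Or.inl rfl) w (hw ▸ hf w)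

theorem Inv.accept {m w : Fin n} (H : Inv p q i (some m) h R) (hw : h w = none)
    (hR : (m, w) ∉ R) (hbest : ∀ w', (m, w') ∉ R → p m w' ≤ p m w) :
    Inv p q i none (Function.update h w (some m)) R := by
  have hfree := (H.free m).2 (Or.inl rfl)
  have hi := H.cur_lt m rfl
  refine ⟨?_, ?_, ?_, ?_, by simp⟩
  · intro a w₁ w₂ h₁ h₂
    simp only [Function.update_apply] at h₁ h₂
    have := H.inj a w₁ w₂
    grind
  · intro a b hb
    simp only [Function.update_apply] at hb
    have := H.top a b
    grind
  · intro a b hab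
    obtain ⟨m', h₁, h₂⟩ := H.rej a b hab
    refine ⟨m', ?_, h₂⟩
    simp only [Function.update_apply]
    grind
  · intro a
    have := H.free a
    constructor
    · intro ha
      have h₁ : ∀ b, h b ≠ some a := fun b hb => by
        have := ha b
        simp only [Function.update_apply] at this
        grind
      have h₂ := ha w
      simp at h₂
      grind
    · intro ha b
      have h₁ := this.2 (Or.inr (by simpa using ha)) b
      have : a ≠ m := by rintro rfl; simp at ha; omega
      simp only [Function.update_apply]
      grind

/-- Holdings only improve: men rejected by `w` earlier rank at most as high as `m'`, who ranks below
`m`, so the new partner justifies all rejections by `w`. -/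
theorem Inv.swap {m m' w : Fin n} (H : Inv p q i (some m) h R) (hw : h w = some m')
    (hlt : q m' w < q m w) (hR : (m, w) ∉ R) (hbest : ∀ w', (m, w') ∉ R → p m w' ≤ p m w) :
    Inv p q i (some m') (Function.update h w (some m)) (insert (m', w) R) := by
  have hfree := (H.free m).2 (Or.inl rfl)
  have hi := H.cur_lt m rfl
  have hne : m ≠ m' := fun e => hfree w (e ▸ hw)
  -- A man who has not entered is free, whereas `m'` is held.
  have hi' : (m' : ℕ) < i := by
    by_contra! hc
    exact (H.free m').2 (Or.inr hc) w hw
  refine ⟨?_, ?_, ?_, ?_, by simpa using hi'⟩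
  · intro a w₁ w₂ h₁ h₂
    simp only [Function.update_apply] at h₁ h₂
    have := H.inj a w₁ w₂
    grind
  · intro a b hb
    simp only [Function.update_apply] at hb
    have := H.top a b
    have := H.inj m' w b hw
    grind
  · intro a b hab
    rw [Finset.mem_insert] at hab
    simp only [Function.update_apply]
    by_cases hbw : b = w
    · subst hbw
      refine ⟨m, by simp, ?_⟩
      rcases hab with hab | hab
      · obtain ⟨rfl, _⟩ := Prod.mk.inj hab
        exact hlt.le
      · obtain ⟨m₁, h₁, h₂⟩ := H.rej a b hab
        obtain rfl : m' = m₁ := Option.some.inj (hw.symm.trans h₁)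
        exact h₂.trans hlt.le
    · simp only [hbw, if_false]
      exact H.rej a b (by grind)
  · intro a
    have := H.free a
    constructor
    · intro ha
      by_cases ham : a = m'
      · exact Or.inl (ham ▸ rfl)
      · have h₁ : ∀ b, h b ≠ some a := fun b hb => by
          have := ha b
          simp only [Function.update_apply] at this
          grind
        have h₂ := ha w
        simp at h₂
        grind
    · rintro (ha | ha) b
      · obtain rfl := Option.some.inj ha
        simp only [Function.update_apply]
        have := H.inj m' w b hw
        grind
      · have h₁ := this.2 (Or.inr ha) b
        have : a ≠ m := by rintro rfl; omega
        simp only [Function.update_apply]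
        grind

theorem Inv.reject {m m' w : Fin n} (H : Inv p q i (some m) h R) (hw : h w = some m')
    (hle : q m w ≤ q m' w) : Inv p q i (some m) h (insert (m, w) R) := by
  have hfree := (H.free m).2 (Or.inl rfl)
  refine ⟨H.inj, ?_, ?_, H.free, H.cur_lt⟩
  · intro a b hb
    have := H.top a b hb
    have : a ≠ m := fun e => hfree b (e ▸ hb)
    grind
  · intro a b hab
    rcases Finset.mem_insert.1 hab with hab | hab
    · obtain ⟨rfl, rfl⟩ := Prod.mk.inj hab
      exact ⟨m', hw, hle⟩
    · exact H.rej a b hab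

/-- Once everyone has entered and nobody proposes, no man is free, so the holdings form a bijection.
For each pair, a rejection is justified by the woman's final partner; without one, the man's partner
is at least as good as `w`. -/
theorem Inv.exists_matching (H : Inv p q i none h R) (hi : n ≤ i) :
    ∃ σ : Equiv.Perm (Fin n), (∀ m, h (σ m) = some m) ∧
      ∀ m w, p m w ≤ p m (σ m) ∨ q m w ≤ q (σ.symm w) w := by
  have hm : ∀ m, ∃ w, h w = some m := by
    intro m
    by_contra! hc
    have := (H.free m).1 hc
    simp only [reduceCtorEq, false_or] at this
    omega
  choose f hf using hm
  have hinj : Function.Injective f := fun m m' e =>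
    Option.some.inj ((hf m).symm.trans (e ▸ hf m'))
  refine ⟨Equiv.ofBijective f (Finite.injective_iff_bijective.1 hinj), hf, fun m w => ?_⟩
  set σ := Equiv.ofBijective f (Finite.injective_iff_bijective.1 hinj)
  by_cases hR : (m, w) ∈ R
  · obtain ⟨m', h₁, h₂⟩ := H.rej m w hR
    have h₃ : h w = some (σ.symm w) := by
      conv_lhs => rw [← σ.apply_symm_apply w]
      exact hf _
    obtain rfl := Option.some.inj (h₁.symm.trans h₃)
    exact Or.inr h₂
  · exact Or.inl ((H.top m (f m) (hf m)).2 w hR)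

end DeferredAcceptance

/-! ### Welfare of matchings that are stable for lexicographic keys -/

namespace SMC

variable {n : ℕ}

/-- The rank of an edge for an agent who values it at `x` and whose partner values it at `y`. -/
def key (x y : ℚ) : ℚ ×ₗ ℚ := toLex (if y = 0 then 0 else x, x + y)

theorem key_le_iff {x y x' y' : ℚ} : key x y ≤ key x' y' ↔
    (if y = 0 then 0 else x) < (if y' = 0 then 0 else x') ∨
      (if y = 0 then 0 else x) = (if y' = 0 then 0 else x') ∧ x + y ≤ x' + y' := by
  simp [key, Prod.Lex.toLex_le_toLex]

/-- Since `y > 0`, the first component of the left key is `x`; that of the right key is `x'` or `0`,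
both at most `x'`. -/
theorem le_of_key_le {x y x' y' : ℚ} (hy : 0 < y) (hx' : 0 ≤ x') (h : key x y ≤ key x' y') :
    x ≤ x' := by
  rw [key_le_iff, if_neg hy.ne'] at h
  split_ifs at h with hy'
  · rcases h with h | h
    · exact h.le.trans hx'
    · exact h.1.le.trans hx'
  · rcases h with h | h
    · exact h.le
    · exact h.1.le

/-- If the first components tie, totals are compared directly. If they differ strictly, the right
one is positive, so `x'` and `y'` are both at least `a`; the worst case is then `x` just below `x'`
with `y = b` and `y' = a`. -/
theorem add_le_of_key_le {a b x y x' y' : ℚ} (ha : 0 < a)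
    (hx : x = 0 ∨ a ≤ x ∧ x ≤ b) (hy : y = 0 ∨ a ≤ y ∧ y ≤ b)
    (hx' : x' = 0 ∨ a ≤ x' ∧ x' ≤ b) (hy' : y' = 0 ∨ a ≤ y' ∧ y' ≤ b)
    (hab : a ≤ b) (h : key x y ≤ key x' y') : x + y ≤ (1 + b / a) / 2 * (x' + y') := by
  have h0 : 0 ≤ x' + y' := by rcases hx' with hx' | hx' <;> rcases hy' with hy' | hy' <;> linarith
  have hc : 1 ≤ b / a := (one_le_div ha).2 hab
  have of_le : x + y ≤ x' + y' → x + y ≤ (1 + b / a) / 2 * (x' + y') := fun h => by nlinarith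
  rw [key_le_iff] at h
  rcases h with h | h
  swap
  · exact of_le h.2
  have hy0 : y' ≠ 0 := by
    rintro rfl
    simp only [if_true] at h
    split_ifs at h <;> rcases hx with hx | hx <;> linarith
  rw [if_neg hy0] at h
  have hy' := hy'.resolve_left hy0
  have hx0 : x' ≠ 0 := by
    rintro rfl
    split_ifs at h <;> rcases hx with hx | hx <;> linarith
  have hx' := hx'.resolve_left hx0
  have hba : b / a * a = b := div_mul_cancel₀ _ ha.ne'
  have hyb : y ≤ b := by rcases hy with hy | hy <;> linarith
  have hxb : x ≤ b := by rcases hx with hx | hx <;> linarith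
  by_cases hyz : y = 0
  · subst hyz
    nlinarith
  · rw [if_neg hyz] at h
    -- Here `x < x'` and `y ≤ b`, and `(b / a - 1) * (x' - a) ≥ 0` turns `x' + b` into at most `(1 +
    -- b / a) / 2 * (x' + a)`.
    nlinarith [mul_nonneg (sub_nonneg.2 hc) (sub_nonneg.2 hx'.1),
      mul_nonneg (sub_nonneg.2 hc) (sub_nonneg.2 hy'.1)]

theorem add_le_of_key_le_of_ternary {α x y x' y' : ℚ} (hα : 1 < α)
    (hx : x ∈ ({0, 1, α} : Set ℚ)) (hy : y ∈ ({0, 1, α} : Set ℚ))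
    (hx' : x' ∈ ({0, 1, α} : Set ℚ)) (hy' : y' ∈ ({0, 1, α} : Set ℚ))
    (h : key x y ≤ key x' y') : x + y ≤ max 2 α / 2 * (x' + y') := by
  simp only [Set.mem_insert_iff, Set.mem_singleton_iff] at hx hy hx' hy'
  have h2 : 2 ≤ max 2 α := le_max_left _ _
  have h3 : α ≤ max 2 α := le_max_right _ _
  -- Only `2 ≤ c` and `α ≤ c` matter from here on.
  generalize max 2 α = c at h2 h3
  rw [key_le_iff] at h
  have h0 : 0 ≤ x' + y' := by
    rcases hx' with hx' | hx' | hx' <;> rcases hy' with hy' | hy' | hy' <;> linarith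
  rcases h with h | h
  · have hα0 : α ≠ 0 := by linarith
    have hy0 : y' ≠ 0 := by
      rintro rfl
      simp only [if_true] at h
      split_ifs at h <;> rcases hx with hx | hx | hx <;> linarith
    rw [if_neg hy0] at h
    have hy' := hy'.resolve_left hy0
    have hx0 : x' ≠ 0 := by
      rintro rfl
      split_ifs at h <;> rcases hx with hx | hx | hx <;> linarith
    have hx' := hx'.resolve_left hx0
    have hy1 : 1 ≤ y' := by rcases hy' with hy' | hy' <;> linarith
    have hx1 : 1 ≤ x' := by rcases hx' with hx' | hx' <;> linarith
    have hyb : y ≤ α := by rcases hy with hy | hy | hy <;> linarith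
    have hxb : x ≤ α := by rcases hx with hx | hx | hx <;> linarith
    by_cases hyz : y = 0
    · subst hyz
      nlinarith
    · rw [if_neg hyz] at h
      -- If `x = 0`, then `y ≤ α ≤ c` and `x' + y' ≥ 2` suffice. If `x = 1`, strictness forces `x' =
      -- α`, so `1 + α ≤ x' + y'`. Nothing exceeds `x = α`.
      rcases hx with hx | hx | hx
      · nlinarith
      · rcases hx' with hx' | hx'
        · linarith
        · nlinarith
      · rcases hx' with hx' | hx' <;> linarith
  · nlinarith [h.2]

/-! ### Permutation matchings: stability and the duality bound. -/

variable (I : SMC n)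

/-- The integral matching that a permutation, from men to women, describes. -/
def permMatching (σ : Equiv.Perm (Fin n)) : Fin n → Fin n → ℝ := fun m w =>
  if σ m = w then 1 else 0

theorem manUtility_permMatching (σ : Equiv.Perm (Fin n)) (m : Fin n) :
    I.manUtility (permMatching σ) m = I.U m (σ m) := by
  simp [manUtility, permMatching]

theorem womanUtility_permMatching (σ : Equiv.Perm (Fin n)) (w : Fin n) :
    I.womanUtility (permMatching σ) w = I.V (σ.symm w) w := by
  simp [womanUtility, permMatching, ← Equiv.eq_symm_apply]

theorem isCompleteMatching_permMatching (σ : Equiv.Perm (Fin n)) :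
    IsCompleteMatching (permMatching σ) := by
  constructor
  · intro m
    simp [permMatching]
  · intro w
    simp [permMatching, ← Equiv.eq_symm_apply]

theorem isIntegralMatching_permMatching (σ : Equiv.Perm (Fin n)) :
    IsIntegralMatching (permMatching σ) := by
  intro m w
  by_cases h : σ m = w <;> simp [permMatching, h]

theorem isFractionalMatching_permMatching (σ : Equiv.Perm (Fin n)) :
    IsFractionalMatching (permMatching σ) where
  nonneg m w := by rcases isIntegralMatching_permMatching σ m w with h | h <;> simp [h]
  man_le m := ((isCompleteMatching_permMatching σ).1 m).le
  woman_le w := ((isCompleteMatching_permMatching σ).2 w).le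

theorem welfare_permMatching (σ : Equiv.Perm (Fin n)) :
    I.welfare (permMatching σ) = ∑ m, ((I.U m (σ m) : ℝ) + I.V m (σ m)) := by
  simp only [welfare, manUtility_permMatching, womanUtility_permMatching,
    Finset.sum_add_distrib]
  congr 1
  rw [← Equiv.sum_comp σ]
  simp

/-- No edge ranks above the edges of `σ` at both of its ends. -/
def IsKeyStable (σ : Equiv.Perm (Fin n)) : Prop :=
  ∀ m w, key (I.U m w) (I.V m w) ≤ key (I.U m (σ m)) (I.V m (σ m)) ∨
    key (I.V m w) (I.U m w) ≤ key (I.V (σ.symm w) w) (I.U (σ.symm w) w)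

variable {I} {σ : Equiv.Perm (Fin n)}

theorem IsKeyStable.isStable (h : I.IsKeyStable σ) : I.IsStable (permMatching σ) := by
  rintro m w ⟨h₁, h₂⟩
  rw [manUtility_permMatching, Rat.cast_lt] at h₁
  rw [womanUtility_permMatching, Rat.cast_lt] at h₂
  -- Both values of a blocking pair are positive, as `le_of_key_le` requires.
  have hU := (I.U_nonneg m (σ m)).trans_lt h₁
  have hV := (I.V_nonneg (σ.symm w) w).trans_lt h₂
  rcases h m w with h | h
  · exact h₁.not_ge (le_of_key_le hV (I.U_nonneg _ _) h)
  · exact h₂.not_ge (le_of_key_le hU (I.V_nonneg _ _) h)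

/-- Weak linear programming duality: the dual solution charges every agent `c / 2` times the
value of its edge in `σ`. -/
theorem welfare_le_of_dominates {c : ℚ} (hc : 0 ≤ c)
    (h : ∀ m w, I.U m w + I.V m w ≤ c / 2 * (I.U m (σ m) + I.V m (σ m)) ∨
      I.U m w + I.V m w ≤ c / 2 * (I.U (σ.symm w) w + I.V (σ.symm w) w))
    {ν : Fin n → Fin n → ℝ} (hν : IsFractionalMatching ν) :
    I.welfare ν ≤ c * I.welfare (permMatching σ) := by
  set y : Fin n → ℝ := fun m => c / 2 * ((I.U m (σ m) : ℝ) + I.V m (σ m)) with hy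
  have hy0 : ∀ m, 0 ≤ y m := fun m => by
    have := I.U_nonneg m (σ m)
    have := I.V_nonneg m (σ m)
    have : (0 : ℚ) ≤ c / 2 * (I.U m (σ m) + I.V m (σ m)) := by positivity
    simp only [hy]
    exact_mod_cast this
  have hcov : ∀ m w, (I.U m w : ℝ) + I.V m w ≤ y m + y (σ.symm w) := by
    intro m w
    rcases h m w with h | h
    · have h' : (I.U m w : ℝ) + I.V m w ≤ y m := by simp only [hy]; exact_mod_cast h
      linarith [hy0 (σ.symm w)]
    · have h' : (I.U m w : ℝ) + I.V m w ≤ y (σ.symm w) := by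
        simp only [hy, Equiv.apply_symm_apply]; exact_mod_cast h
      linarith [hy0 m]
  calc I.welfare ν = ∑ m, ∑ w, ((I.U m w : ℝ) + I.V m w) * ν m w := by
        simp only [welfare, manUtility, womanUtility, add_mul, Finset.sum_add_distrib]
        congr 1
        exact Finset.sum_comm
    _ ≤ ∑ m, ∑ w, (y m + y (σ.symm w)) * ν m w := by
        exact Finset.sum_le_sum fun m _ => Finset.sum_le_sum fun w _ =>
          mul_le_mul_of_nonneg_right (hcov m w) (hν.nonneg m w)
    _ = ∑ m, y m * ∑ w, ν m w + ∑ w, y (σ.symm w) * ∑ m, ν m w := by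
        simp only [add_mul, Finset.sum_add_distrib, Finset.mul_sum]
        congr 1
        exact Finset.sum_comm
    _ ≤ ∑ m, y m * 1 + ∑ w, y (σ.symm w) * 1 := by
        gcongr with m _ w _
        · exact hy0 m
        · exact hν.man_le m
        · exact hy0 _
        · exact hν.woman_le w
    _ = c * I.welfare (permMatching σ) := by
        simp only [mul_one]
        -- Reindexed along `σ`, the women's charges equal the men's, and the two halves add up to
        -- `c`.
        rw [Equiv.sum_comp σ.symm y, welfare_permMatching, Finset.mul_sum,
          ← Finset.sum_add_distrib]
        refine Finset.sum_congr rfl fun m _ => ?_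
        simp only [hy]
        ring

theorem IsKeyStable.welfare_ge_of_isTernary (h : I.IsKeyStable σ) {α : ℚ} (hα : I.IsTernary α)
    {ν : Fin n → Fin n → ℝ} (hν : IsFractionalMatching ν) :
    I.welfare (permMatching σ) ≥ min (1 / 2) (1 / (α : ℝ)) * I.welfare ν := by
  have hc : (2 : ℚ) ≤ max 2 α := le_max_left _ _
  have hmain := welfare_le_of_dominates (c := max 2 α) (I := I) (σ := σ) (by linarith)
    (fun m w => (h m w).imp
      (fun h => add_le_of_key_le_of_ternary hα.1 (hα.2 _ _).1 (hα.2 _ _).2 (hα.2 _ _).1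
        (hα.2 _ _).2 h)
      (fun h => by
        rw [add_comm (I.U m w), add_comm (I.U (σ.symm w) w)]
        exact add_le_of_key_le_of_ternary hα.1 (hα.2 _ _).2 (hα.2 _ _).1 (hα.2 _ _).2
          (hα.2 _ _).1 h)) hν
  have hα0 : (1 : ℝ) < α := by exact_mod_cast hα.1
  have hmin : min (1 / 2) (1 / (α : ℝ)) = ((max 2 α : ℚ) : ℝ)⁻¹ := by
    rw [Rat.cast_max, Rat.cast_ofNat]
    rcases le_total (2 : ℝ) α with h2 | h2
    · rw [max_eq_right h2, min_eq_right (one_div_le_one_div_of_le two_pos h2), one_div]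
    · rw [max_eq_left h2, min_eq_left (one_div_le_one_div_of_le (by linarith) h2), one_div]
  have hc' : (0 : ℝ) < ((max 2 α : ℚ) : ℝ) := by exact_mod_cast lt_of_lt_of_le two_pos hc
  rw [hmin, ge_iff_le, inv_mul_le_iff₀ hc']
  exact hmain

theorem IsKeyStable.welfare_ge (h : I.IsKeyStable σ) {b a : ℚ}
    (hb : IsGreatest I.nonzeroValuations b) (ha : IsLeast I.nonzeroValuations a)
    {ν : Fin n → Fin n → ℝ} (hν : IsFractionalMatching ν) :
    I.welfare (permMatching σ) ≥ (1 + (b : ℝ) / (a : ℝ))⁻¹ * I.welfare ν := by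
  have ha0 : 0 < a := by
    obtain ⟨h0, m, w, e | e⟩ := ha.1
    · exact lt_of_le_of_ne (e ▸ I.U_nonneg m w) h0.symm
    · exact lt_of_le_of_ne (e ▸ I.V_nonneg m w) h0.symm
  have hab : a ≤ b := hb.2 ha.1
  have hb0 : 0 < b := ha0.trans_le hab
  have hU : ∀ m w, I.U m w = 0 ∨ a ≤ I.U m w ∧ I.U m w ≤ b := fun m w => by
    by_cases h0 : I.U m w = 0
    · exact Or.inl h0
    · have hmem : I.U m w ∈ I.nonzeroValuations := ⟨h0, m, w, Or.inl rfl⟩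
      exact Or.inr ⟨ha.2 hmem, hb.2 hmem⟩
  have hV : ∀ m w, I.V m w = 0 ∨ a ≤ I.V m w ∧ I.V m w ≤ b := fun m w => by
    by_cases h0 : I.V m w = 0
    · exact Or.inl h0
    · have hmem : I.V m w ∈ I.nonzeroValuations := ⟨h0, m, w, Or.inr rfl⟩
      exact Or.inr ⟨ha.2 hmem, hb.2 hmem⟩
  have hc : 0 < 1 + b / a := by positivity
  have hmain := welfare_le_of_dominates (c := 1 + b / a) (I := I) (σ := σ) hc.le
    (fun m w => (h m w).imp
      (fun h => add_le_of_key_le ha0 (hU _ _) (hV _ _) (hU _ _) (hV _ _) hab h)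
      (fun h => by
        rw [add_comm (I.U m w), add_comm (I.U (σ.symm w) w)]
        exact add_le_of_key_le ha0 (hV _ _) (hU _ _) (hV _ _) (hU _ _) hab h)) hν
  have hc' : (0 : ℝ) < 1 + (b : ℝ) / a := by exact_mod_cast hc
  rw [ge_iff_le, inv_mul_le_iff₀ hc']
  have e : (((1 + b / a : ℚ)) : ℝ) = 1 + (b : ℝ) / a := by push_cast; rfl
  rw [← e]
  exact hmain

end SMC

/-! ### Running times of programs -/

namespace RAM

theorem bitLength_pos (z : ℤ) : 1 ≤ bitLength z := by simp [bitLength]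

theorem bitLength_le_succ_iff {z : ℤ} {b : ℕ} : bitLength z ≤ b + 1 ↔ z.natAbs < 2 ^ b := by
  simp [bitLength, Nat.size_le]

theorem natAbs_lt_two_pow_bitLength (z : ℤ) : z.natAbs < 2 ^ (bitLength z - 1) := by
  simpa [bitLength] using Nat.lt_size_self z.natAbs

theorem bitLength_mono {y z : ℤ} (h : y.natAbs ≤ z.natAbs) : bitLength y ≤ bitLength z :=
  Nat.succ_le_succ (Nat.size_le_size h)

/-- The two sign bits leave room for the carry: `2 ^ a + 2 ^ b ≤ 2 ^ (a + b + 1)`. -/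
theorem bitLength_le_add {x y z : ℤ} (h : z.natAbs ≤ x.natAbs + y.natAbs) :
    bitLength z ≤ bitLength x + bitLength y := by
  have hx := natAbs_lt_two_pow_bitLength x
  have hy := natAbs_lt_two_pow_bitLength y
  obtain ⟨a, ha⟩ := Nat.exists_eq_add_of_le (bitLength_pos x)
  obtain ⟨b, hb⟩ := Nat.exists_eq_add_of_le (bitLength_pos y)
  rw [ha] at hx ⊢
  rw [hb] at hy ⊢
  rw [show 1 + a + (1 + b) = (a + b + 1) + 1 by ring, bitLength_le_succ_iff]
  simp only [Nat.add_sub_cancel_left] at hx hy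
  have h1 : 2 ^ a ≤ 2 ^ (a + b) := Nat.pow_le_pow_right two_pos (by omega)
  have h2 : 2 ^ b ≤ 2 ^ (a + b) := Nat.pow_le_pow_right two_pos (by omega)
  rw [pow_succ]
  omega

theorem bitLength_mul_le (x y : ℤ) : bitLength (x * y) ≤ bitLength x + bitLength y := by
  have hx := natAbs_lt_two_pow_bitLength x
  have hy := natAbs_lt_two_pow_bitLength y
  obtain ⟨a, ha⟩ := Nat.exists_eq_add_of_le (bitLength_pos x)
  obtain ⟨b, hb⟩ := Nat.exists_eq_add_of_le (bitLength_pos y)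
  rw [ha] at hx ⊢
  rw [hb] at hy ⊢
  rw [show 1 + a + (1 + b) = (a + b + 1) + 1 by ring, bitLength_le_succ_iff, Int.natAbs_mul]
  simp only [Nat.add_sub_cancel_left] at hx hy
  calc x.natAbs * y.natAbs < 2 ^ a * 2 ^ b := Nat.mul_lt_mul'' hx hy
    _ ≤ 2 ^ (a + b + 1) := by rw [← pow_add]; exact Nat.pow_le_pow_right two_pos (by omega)

theorem bitLength_op_le (o : Op) (x y : ℤ) :
    bitLength (o.val x y) ≤ bitLength x + bitLength y := by
  have h2 : ∀ (p : Prop) [Decidable p],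
      bitLength (if p then 1 else 0) ≤ bitLength x + bitLength y := fun p _ => by
    have h1 : bitLength (if p then 1 else 0) ≤ 2 := by split_ifs <;> simp [bitLength]
    have := bitLength_pos x
    have := bitLength_pos y
    omega
  cases o with
  | add => exact bitLength_le_add (Int.natAbs_add_le _ _)
  | sub => exact bitLength_le_add (Int.natAbs_sub_le _ _)
  | mul => exact bitLength_mul_le x y
  | div => exact (bitLength_mono (Int.natAbs_ediv_le_natAbs x y)).trans (Nat.le_add_right _ _)
  | lt => exact h2 _
  | eq => exact h2 _

/-- All cells hold integers of bit length at most `B`. -/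
def Bounded (B : ℕ) (s : Store) : Prop := ∀ a k, bitLength (s a k) ≤ B

/-- The factor by which evaluating an expression can exceed the bit length of the cells. -/
def Expr.weight : Expr → ℕ
  | .const c => bitLength c
  | .read _ k => k.weight + 1
  | .bin _ x y => 2 * (x.weight + y.weight)

/-- Length and cost are bounded together because the result of an operation is charged through the
lengths of its operands; this is the factor `2` in the weight of `bin`. -/
theorem Expr.cost_le {B : ℕ} {s : Store} (hB : 1 ≤ B) (hs : Bounded B s) (e : Expr) :
    bitLength (e.val s) ≤ e.weight * B ∧ e.cost s ≤ e.weight * B := by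
  induction e with
  | const c => simpa [Expr.val, Expr.cost, Expr.weight] using Nat.le_mul_of_pos_right _ hB
  | read a k ih =>
    have := hs a (k.val s)
    simp only [Expr.val, Expr.cost, Expr.weight, add_mul, one_mul]
    omega
  | bin o x y hx hy =>
    have := bitLength_op_le o (x.val s) (y.val s)
    simp only [Expr.val, Expr.cost, Expr.weight, mul_assoc, add_mul]
    omega

open Polynomial in
/-- A time bound for runs in which, for an input of size `X`, all cells hold integers of bit
length at most `X + 2` and every loop makes at most `X ^ 2 + 2 * X` iterations. -/
noncomputable def Prog.bound : Prog → Polynomial ℕ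
  | .skip => 1
  | .assign _ k v => C (k.weight + v.weight) * (X + 2) + 1
  | .seq p q => p.bound + q.bound
  | .cond e p q => C e.weight * (X + 2) + 1 + (p.bound + q.bound)
  | .loop e p => (X ^ 2 + 2 * X + 1) * (C e.weight * (X + 2) + 1 + p.bound)

/-- The store after writing `v` into cell `k` of array `a`. -/
def Store.set (s : Store) (a : ℕ) (k v : ℤ) : Store :=
  Function.update s a (Function.update (s a) k v)

theorem Store.set_apply (s : Store) (a b : ℕ) (k l v : ℤ) :
    s.set a k v b l = if b = a ∧ l = k then v else s b l := by
  by_cases h : b = a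
  · subst h
    by_cases h' : l = k <;> simp [Store.set, h']
  · simp [Store.set, h]

theorem Bounded.set {B : ℕ} {s : Store} (hs : Bounded B s) (a : ℕ) (k : ℤ) {v : ℤ}
    (hv : bitLength v ≤ B) : Bounded B (s.set a k v) := by
  intro b l
  rw [Store.set_apply]
  split_ifs
  · exact hv
  · exact hs b l

/-- `p`, started in `s`, halts within its time bound for inputs of size `L` in a store that
satisfies `Q`. -/
def Runs (L : ℕ) (p : Prog) (s : Store) (Q : Store → Prop) : Prop :=
  ∃ s' t, Exec p s s' t ∧ t ≤ p.bound.eval L ∧ Q s'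

/-! ### Proof rules for runs within the time bound. -/

variable {L : ℕ} {p q : Prog} {s : Store} {e : Expr} {Q Q' : Store → Prop}

theorem Expr.cost_le_eval (hs : Bounded (L + 2) s) (e : Expr) :
    e.cost s ≤ e.weight * (L + 2) :=
  (e.cost_le (by omega) hs).2

theorem Runs.mono (h : Runs L p s Q) (hQ : ∀ s', Q s' → Q' s') : Runs L p s Q' := by
  obtain ⟨s', t, h₁, h₂, h₃⟩ := h
  exact ⟨s', t, h₁, h₂, hQ _ h₃⟩

theorem Runs.skip (h : Q s) : Runs L .skip s Q :=
  ⟨s, 1, .skip s, by simp [Prog.bound], h⟩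

theorem Runs.assign (hs : Bounded (L + 2) s) {a : ℕ} {k v : Expr}
    (h : Q (s.set a (k.val s) (v.val s))) : Runs L (.assign a k v) s Q := by
  refine ⟨_, _, .assign a k v s, ?_, h⟩
  have := k.cost_le_eval hs
  have := v.cost_le_eval hs
  simp only [Prog.bound, Polynomial.eval_add, Polynomial.eval_mul, Polynomial.eval_C,
    Polynomial.eval_X, Polynomial.eval_ofNat, Polynomial.eval_one, add_mul]
  omega

theorem Runs.seq (h : Runs L p s fun s' => Runs L q s' Q) : Runs L (.seq p q) s Q := by
  obtain ⟨s', t, h₁, h₂, s'', t', h₃, h₄, h₅⟩ := h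
  refine ⟨s'', t + t', .seq h₁ h₃, ?_, h₅⟩
  rw [Prog.bound, Polynomial.eval_add]
  omega

theorem Runs.cond (hs : Bounded (L + 2) s) (hp : e.val s ≠ 0 → Runs L p s Q)
    (hq : e.val s = 0 → Runs L q s Q) : Runs L (.cond e p q) s Q := by
  have := e.cost_le_eval hs
  by_cases he : e.val s = 0
  · obtain ⟨s', t, h₁, h₂, h₃⟩ := hq he
    refine ⟨s', _, .cond_false he h₁, ?_, h₃⟩
    simp only [Prog.bound, Polynomial.eval_add, Polynomial.eval_mul, Polynomial.eval_C,
      Polynomial.eval_X, Polynomial.eval_ofNat, Polynomial.eval_one]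
    omega
  · obtain ⟨s', t, h₁, h₂, h₃⟩ := hp he
    refine ⟨s', _, .cond_true he h₁, ?_, h₃⟩
    simp only [Prog.bound, Polynomial.eval_add, Polynomial.eval_mul, Polynomial.eval_C,
      Polynomial.eval_X, Polynomial.eval_ofNat, Polynomial.eval_one]
    omega

/-- The rule for loops, with an invariant that is indexed by a bound on the number of
iterations that are left. -/
theorem Runs.loop {P : ℕ → Store → Prop} (hP : ∀ k s, P k s → Bounded (L + 2) s)
    (hstep : ∀ k s, P k s → e.val s ≠ 0 → Runs L p s fun s' => ∃ k' < k, P k' s')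
    (hexit : ∀ k s, P k s → e.val s = 0 → Q s) {k : ℕ} (hk : k ≤ L ^ 2 + 2 * L) (h : P k s) :
    Runs L (.loop e p) s Q := by
  -- The extra `1` in `k + 1` pays for the final, failing test.
  have key : ∀ k s, P k s → ∃ s' t, Exec (.loop e p) s s' t ∧
      t ≤ (k + 1) * (e.weight * (L + 2) + 1 + p.bound.eval L) ∧ Q s' := by
    intro k
    induction k using Nat.strong_induction_on with
    | _ k ih =>
      intro s h
      have hc := e.cost_le_eval (hP k s h)
      by_cases he : e.val s = 0
      · refine ⟨s, _, .loop_false he, ?_, hexit k s h he⟩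
        calc e.cost s + 1 ≤ 1 * (e.weight * (L + 2) + 1 + p.bound.eval L) := by omega
          _ ≤ _ := Nat.mul_le_mul_right _ (by omega)
      · obtain ⟨s', t, h₁, h₂, k', hk', h₃⟩ := hstep k s h he
        obtain ⟨s'', t', h₄, h₅, h₆⟩ := ih k' hk' s' h₃
        refine ⟨s'', _, .loop_true he h₁ h₄, ?_, h₆⟩
        calc e.cost s + 1 + t + t'
            ≤ (e.weight * (L + 2) + 1 + p.bound.eval L) +
              (k' + 1) * (e.weight * (L + 2) + 1 + p.bound.eval L) := by omega
          _ = (k' + 1 + 1) * (e.weight * (L + 2) + 1 + p.bound.eval L) := by ring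
          _ ≤ _ := Nat.mul_le_mul_right _ (by omega)
  obtain ⟨s', t, h₁, h₂, h₃⟩ := key k s h
  refine ⟨s', t, h₁, h₂.trans ?_, h₃⟩
  simp only [Prog.bound, Polynomial.eval_add, Polynomial.eval_mul, Polynomial.eval_C,
    Polynomial.eval_X, Polynomial.eval_ofNat, Polynomial.eval_one, Polynomial.eval_pow]
  exact Nat.mul_le_mul_right _ (by omega)

end RAM

/-! ### The encoding of an instance -/

theorem List.getD_flatMap_of_length_eq {α β : Type*} (l : List α) (f : α → List β) {k : ℕ}
    (hf : ∀ a, (f a).length = k) (d : β) {i r : ℕ} (hi : i < l.length) (hr : r < k) :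
    (l.flatMap f).getD (i * k + r) d = (f l[i]).getD r d := by
  induction l generalizing i with
  | nil => simp at hi
  | cons a l ih =>
    cases i with
    | zero =>
      rw [List.flatMap_cons, List.getD_append _ _ _ _ (by rw [hf]; omega)]
      simp
    | succ i =>
      rw [List.flatMap_cons, List.getD_append_right _ _ _ _ (by rw [hf]; nlinarith), hf,
        show (i + 1) * k + r - k = i * k + r by rw [add_mul]; omega]
      simpa using ih (by simpa using hi)

namespace SMC

variable {n : ℕ} (I : SMC n)

theorem getD_encode (m w : Fin n) {r : ℕ} (hr : r < 4) :
    I.encode.getD (1 + 4 * (m * n + w) + r) 0 =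
      [(I.U m w).num, ((I.U m w).den : ℤ), (I.V m w).num, ((I.V m w).den : ℤ)].getD r 0 := by
  have hw := w.isLt
  rw [encode, show 1 + 4 * ((m : ℕ) * n + w) + r = (m * (n * 4) + (w * 4 + r)) + 1 by ring,
    List.getD_cons_succ, List.getD_flatMap_of_length_eq _ _ (k := n * 4) _ _ (by simp) (by omega),
    List.getD_flatMap_of_length_eq _ _ (k := 4) _ _ (by simp) hr]
  · simp
  · simp
  · intro a
    simp [List.length_flatMap]

theorem length_encode : I.encode.length = 1 + n * (n * 4) := by
  simp [encode, List.length_flatMap, add_comm]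

theorem length_le_inputSize (x : List ℤ) : x.length ≤ RAM.inputSize x := by
  induction x with
  | nil => simp
  | cons a x ih =>
    have := RAM.bitLength_pos a
    simp only [RAM.inputSize, List.length_cons, List.map_cons, List.sum_cons] at *
    omega

theorem le_inputSize_encode : n ≤ RAM.inputSize I.encode := by
  refine le_trans ?_ (length_le_inputSize _)
  rw [length_encode]
  nlinarith [Nat.le_mul_self n]

theorem bitLength_getD_le (x : List ℤ) (k : ℕ) :
    RAM.bitLength (x.getD k 0) ≤ RAM.inputSize x + 1 := by
  by_cases hk : k < x.length
  · rw [List.getD_eq_getElem _ _ hk]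
    exact (List.single_le_sum (by simp) _
      (List.mem_map_of_mem (List.getElem_mem hk))).trans (Nat.le_succ _)
  · rw [List.getD_eq_default _ _ (by omega)]
    simp [RAM.bitLength]

theorem bounded_initial : RAM.Bounded (RAM.inputSize I.encode + 2) (RAM.initial I.encode) := by
  intro a k
  simp only [RAM.initial]
  split_ifs
  · exact (bitLength_getD_le _ _).trans (Nat.le_succ _)
  · simp [RAM.bitLength]

/-- The input contains `n` itself, so `n < 2 ^ L` for input size `L`, and `v ≤ n + 1` fits into `L +
1` bits and a sign. This is where the cell bound `L + 2` comes from. -/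
theorem bitLength_le_of_le {v : ℤ} (h0 : 0 ≤ v) (hv : v ≤ n + 1) :
    RAM.bitLength v ≤ RAM.inputSize I.encode + 2 := by
  have h1 : RAM.bitLength (n : ℤ) ≤ RAM.inputSize I.encode := by
    simp [encode, RAM.inputSize]
  have h2 := RAM.natAbs_lt_two_pow_bitLength (n : ℤ)
  have h3 : (2 : ℕ) ^ (RAM.bitLength (n : ℤ) - 1) ≤ 2 ^ RAM.inputSize I.encode :=
    Nat.pow_le_pow_right two_pos (by omega)
  rw [RAM.bitLength_le_succ_iff, pow_succ]
  omega

end SMC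

/-! ### Deferred acceptance as a program

Arrays `0` and `1` are the input and the output. Array `2` holds the partner of each woman,
array `3` the rejections, and cell `0` of the arrays `4`, `5`, `6`, `7` the number of men that
have entered, the proposing man, his best woman so far, and a counter. In arrays `2` to `7` agents
are numbered from one, and zero stands for nobody. -/

namespace DeferredAcceptance

open RAM

/-- The variable in cell `0` of array `a`. -/
def var (a : ℕ) : Expr := .read a (.const 0)

/-- The index of cell `(x, y)` of a matrix. -/
def cell (x y : Expr) : Expr := .bin .add (.bin .mul x (var 0)) y

/-- The predecessor of `x`. -/
def pred (x : Expr) : Expr := .bin .sub x (.const 1)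

/-- The successor of `x`. -/
def succ (x : Expr) : Expr := .bin .add x (.const 1)

/-- The `r`-th of the four numbers that encode the valuations of man `m` and woman `w`. -/
def entry (m w : Expr) (r : ℤ) : Expr :=
  .read 0 (.bin .add
    (.bin .add (.const 1) (.bin .mul (.const 4) (cell (pred m) (pred w)))) (.const r))

/-- Compares the keys of the edges with entries `e` and `e'`, for the men if `o = 0` and for the
women if `o = 2`. -/
def keyLt (e e' : ℤ → Expr) (o : ℤ) : Expr :=
  let primary (e e' : ℤ → Expr) : Expr :=
    .bin .mul (.bin .mul (e o) (.bin .lt (.const 0) (e (2 - o)))) (e' (o + 1))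
  let total (e e' : ℤ → Expr) : Expr :=
    .bin .mul (.bin .add (.bin .mul (e o) (e (3 - o))) (.bin .mul (e (2 - o)) (e (o + 1))))
      (.bin .mul (e' (o + 1)) (e' (3 - o)))
  .bin .add (.bin .lt (primary e e') (primary e' e))
    (.bin .mul (.bin .eq (primary e e') (primary e' e)) (.bin .lt (total e e') (total e' e)))

/-- Cross-multiplication by positive denominators turns both key comparisons into integer
comparisons. As `y` and `y'` are non-negative, positivity of a numerator tests for non-zero. The
offsets `o`, `o + 1`, `2 - o`, `3 - o` exchange the two valuations when `o` passes from `0` to `2`.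
-/
theorem keyLt_val_ne_zero_iff {s : Store} {e e' : ℤ → Expr} {o : ℤ} {x y x' y' : ℚ}
    (hy : 0 ≤ y) (hy' : 0 ≤ y')
    (h₀ : (e o).val s = x.num) (h₁ : (e (o + 1)).val s = x.den)
    (h₂ : (e (2 - o)).val s = y.num) (h₃ : (e (3 - o)).val s = y.den)
    (h₀' : (e' o).val s = x'.num) (h₁' : (e' (o + 1)).val s = x'.den)
    (h₂' : (e' (2 - o)).val s = y'.num) (h₃' : (e' (3 - o)).val s = y'.den) :
    (keyLt e e' o).val s ≠ 0 ↔ SMC.key x y < SMC.key x' y' := by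
  have hpos : ∀ z : ℚ, (0 : ℚ) < z.den := fun z => by exact_mod_cast z.den_pos
  have hnum : ∀ z : ℚ, (z.num : ℚ) = z * z.den := fun z => (Rat.mul_den_eq_num z).symm
  have hind : ∀ z : ℚ, 0 ≤ z → ((if 0 < z.num then 1 else 0 : ℤ) : ℚ) = if z = 0 then 0 else 1 := by
    intro z hz
    rcases hz.eq_or_lt with rfl | hz
    · simp
    · simp [Rat.num_pos.2 hz, hz.ne']
  set P : ℤ := x.num * (if 0 < y.num then 1 else 0) * x'.den with hP
  set P' : ℤ := x'.num * (if 0 < y'.num then 1 else 0) * x.den with hP'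
  set S : ℤ := (x.num * y.den + y.num * x.den) * (x'.den * y'.den) with hS
  set S' : ℤ := (x'.num * y'.den + y'.num * x'.den) * (x.den * y.den) with hS'
  have eP : (P : ℚ) = (if y = 0 then 0 else x) * (x.den * x'.den) := by
    rw [hP, Int.cast_mul, Int.cast_mul, hind y hy, hnum]
    push_cast
    split_ifs <;> ring
  have eP' : (P' : ℚ) = (if y' = 0 then 0 else x') * (x.den * x'.den) := by
    rw [hP', Int.cast_mul, Int.cast_mul, hind y' hy', hnum]
    push_cast
    split_ifs <;> ring
  have eS : (S : ℚ) = (x + y) * ((x.den * y.den) * (x'.den * y'.den)) := by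
    rw [hS]
    push_cast
    rw [hnum, hnum]
    ring
  have eS' : (S' : ℚ) = (x' + y') * ((x.den * y.den) * (x'.den * y'.den)) := by
    rw [hS']
    push_cast
    rw [hnum, hnum]
    ring
  have hp : (0 : ℚ) < x.den * x'.den := mul_pos (hpos _) (hpos _)
  have hs : (0 : ℚ) < (x.den * y.den) * (x'.den * y'.den) :=
    mul_pos (mul_pos (hpos _) (hpos _)) (mul_pos (hpos _) (hpos _))
  have hval : (keyLt e e' o).val s =
      (if P < P' then 1 else 0) + (if P = P' then 1 else 0) * (if S < S' then 1 else 0) := by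
    simp only [keyLt, Expr.val, Op.val, h₀, h₁, h₂, h₃, h₀', h₁', h₂', h₃', P, P', S, S']
  have hlt : P < P' ↔ (if y = 0 then 0 else x) < (if y' = 0 then 0 else x') := by
    rw [← Int.cast_lt (R := ℚ), eP, eP', mul_lt_mul_iff_left₀ hp]
  have heq : P = P' ↔ (if y = 0 then 0 else x) = (if y' = 0 then 0 else x') := by
    rw [← Int.cast_inj (α := ℚ), eP, eP', mul_left_inj' hp.ne']
  have hltS : S < S' ↔ x + y < x' + y' := by
    rw [← Int.cast_lt (R := ℚ), eS, eS', mul_lt_mul_iff_left₀ hs]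
  rw [hval, SMC.key, SMC.key, Prod.Lex.toLex_lt_toLex, ← hlt, ← heq, ← hltS]
  by_cases h1 : P < P'
  · simp only [h1, h1.ne, if_true, if_false]
    simp
  · by_cases h2 : P = P' <;> by_cases h3 : S < S' <;> simp [h1, h2, h3]

/-- The search for the woman whom man `var 5` ranks highest among those who have not rejected
him. -/
def search : Prog :=
  .seq (.assign 6 (.const 0) (.const 0)) <|
  .seq (.assign 7 (.const 0) (.const 0)) <|
  .loop (.bin .lt (var 7) (var 0)) <|
    .seq (.assign 7 (.const 0) (succ (var 7))) <|
    .cond (.read 3 (cell (var 5) (var 7))) .skip <|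
    .cond (var 6)
      (.cond (keyLt (entry (var 5) (var 6)) (entry (var 5) (var 7)) 0)
        (.assign 6 (.const 0) (var 7)) .skip)
      (.assign 6 (.const 0) (var 7))

/-- Man `var 5` proposes to woman `var 6`. -/
def propose : Prog :=
  .cond (.read 2 (var 6))
    (.cond (keyLt (entry (.read 2 (var 6)) (var 6)) (entry (var 5) (var 6)) 2)
      (.seq (.assign 3 (cell (.read 2 (var 6)) (var 6)) (.const 1)) <|
        .seq (.assign 7 (.const 0) (.read 2 (var 6))) <|
        .seq (.assign 2 (var 6) (var 5)) <|
        .assign 5 (.const 0) (var 7))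
      (.assign 3 (cell (var 5) (var 6)) (.const 1)))
    (.seq (.assign 2 (var 6) (var 5)) (.assign 5 (.const 0) (.const 0)))

/-- The next man enters. -/
def enter : Prog :=
  .seq (.assign 4 (.const 0) (succ (var 4))) (.assign 5 (.const 0) (var 4))

/-- Writing the matching into the output array. -/
def write : Prog :=
  .seq (.assign 7 (.const 0) (.const 0)) <|
  .loop (.bin .lt (var 7) (var 0)) <|
    .seq (.assign 7 (.const 0) (succ (var 7))) <|
    .assign 1 (cell (pred (.read 2 (var 7))) (pred (var 7))) (.const 1)

/-- Deferred acceptance. -/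
def program : Prog :=
  .seq (.loop (.bin .add (.bin .lt (var 4) (var 0)) (var 5))
      (.cond (var 5) (.seq search propose) enter))
    write

/-- The number of an agent, counted from one; zero for nobody. -/
def code {n : ℕ} : Option (Fin n) → ℤ
  | none => 0
  | some a => a + 1

variable {n : ℕ}

@[simp] theorem code_none : code (none : Option (Fin n)) = 0 := rfl

@[simp] theorem code_some (a : Fin n) : code (some a) = a + 1 := rfl

theorem code_nonneg (a : Option (Fin n)) : 0 ≤ code a := by
  cases a <;> grind [code]

theorem code_le (a : Option (Fin n)) : code a ≤ n := by
  cases a <;> grind [code]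

theorem code_inj {a b : Option (Fin n)} (h : code a = code b) : a = b := by
  cases a <;> cases b <;> simp [Fin.ext_iff] at * <;> omega

/-- Row and column are the quotient and remainder modulo `n`, so a write to one matrix cell leaves
the others intact. -/
theorem cell_inj {m m' w w' : Fin n} (h : (m : ℤ) * n + w = m' * n + w') : m = m' ∧ w = w' := by
  have hw := w.isLt
  have hw' := w'.isLt
  have h' : (m : ℕ) * n + w = m' * n + w' := by exact_mod_cast h
  have h₁ := congrArg (· / n) h'
  have h₂ := congrArg (· % n) h'
  have hn : 0 < n := by omega
  simp only [mul_comm _ n, Nat.mul_add_div hn, Nat.mul_add_mod, Nat.div_eq_of_lt hw,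
    Nat.div_eq_of_lt hw', Nat.mod_eq_of_lt hw, Nat.mod_eq_of_lt hw', add_zero] at h₁ h₂
  exact ⟨Fin.ext h₁, Fin.ext h₂⟩

theorem cell_succ_inj {m m' w w' : Fin n}
    (h : ((m : ℤ) + 1) * n + (w + 1) = (m' + 1) * n + (w' + 1)) : m = m' ∧ w = w' :=
  cell_inj (by linarith)

/-- The store `s` represents a state of deferred acceptance. -/
structure Rep (I : SMC n) (s : Store) (i : ℤ) (cur best : Option (Fin n)) (j : ℤ)
    (h : Fin n → Option (Fin n)) (R : Finset (Fin n × Fin n)) (o : Fin n → Fin n → ℤ) : Prop where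
  bounded : Bounded (inputSize I.encode + 2) s
  input : ∀ k, s 0 k = initial I.encode 0 k
  out : ∀ m w : Fin n, s 1 (m * n + w) = o m w
  husb : ∀ w : Fin n, s 2 (w + 1) = code (h w)
  rej : ∀ m w : Fin n, s 3 ((m + 1) * n + (w + 1)) = if (m, w) ∈ R then 1 else 0
  entered : s 4 0 = i
  cur : s 5 0 = code cur
  best : s 6 0 = code best
  counter : s 7 0 = j

/-! ### Effect of single writes, and values read from a represented state. -/

namespace Rep

variable {I : SMC n} {s : Store} {i : ℤ} {cur best : Option (Fin n)} {j : ℤ}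
    {h : Fin n → Option (Fin n)} {R : Finset (Fin n × Fin n)} {o : Fin n → Fin n → ℤ}

theorem initial (I : SMC n) : Rep I (RAM.initial I.encode) 0 none none 0 (fun _ => none) ∅ 0 := by
  refine ⟨I.bounded_initial, fun k => rfl, ?_, ?_, ?_, ?_, ?_, ?_, ?_⟩ <;>
    simp [RAM.initial]

theorem size (H : Rep I s i cur best j h R o) : s 0 0 = n := by
  simp [H.input, RAM.initial, SMC.encode]

theorem set_entered (H : Rep I s i cur best j h R o) {v : ℤ} (h0 : 0 ≤ v) (hv : v ≤ n + 1) :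
    Rep I (s.set 4 0 v) v cur best j h R o := by
  refine ⟨H.bounded.set _ _ (I.bitLength_le_of_le h0 hv), ?_, ?_, ?_, ?_, ?_, ?_, ?_, ?_⟩ <;>
    simp [Store.set_apply, H.input, H.out, H.husb, H.rej, H.cur, H.best, H.counter]

theorem set_cur (H : Rep I s i cur best j h R o) (c : Option (Fin n)) :
    Rep I (s.set 5 0 (code c)) i c best j h R o := by
  refine ⟨H.bounded.set _ _ (I.bitLength_le_of_le (code_nonneg c) (by linarith [code_le c])),
    ?_, ?_, ?_, ?_, ?_, ?_, ?_, ?_⟩ <;>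
    simp [Store.set_apply, H.input, H.out, H.husb, H.rej, H.entered, H.best, H.counter]

theorem set_best (H : Rep I s i cur best j h R o) (c : Option (Fin n)) :
    Rep I (s.set 6 0 (code c)) i cur c j h R o := by
  refine ⟨H.bounded.set _ _ (I.bitLength_le_of_le (code_nonneg c) (by linarith [code_le c])),
    ?_, ?_, ?_, ?_, ?_, ?_, ?_, ?_⟩ <;>
    simp [Store.set_apply, H.input, H.out, H.husb, H.rej, H.entered, H.cur, H.counter]

theorem set_counter (H : Rep I s i cur best j h R o) {v : ℤ} (h0 : 0 ≤ v) (hv : v ≤ n + 1) :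
    Rep I (s.set 7 0 v) i cur best v h R o := by
  refine ⟨H.bounded.set _ _ (I.bitLength_le_of_le h0 hv), ?_, ?_, ?_, ?_, ?_, ?_, ?_, ?_⟩ <;>
    simp [Store.set_apply, H.input, H.out, H.husb, H.rej, H.entered, H.cur, H.best]

theorem set_husb (H : Rep I s i cur best j h R o) (w : Fin n) (c : Option (Fin n)) :
    Rep I (s.set 2 (w + 1) (code c)) i cur best j (Function.update h w c) R o := by
  refine ⟨H.bounded.set _ _ (I.bitLength_le_of_le (code_nonneg c) (by linarith [code_le c])),
    ?_, ?_, fun w' => ?_, ?_, ?_, ?_, ?_, ?_⟩ <;>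
    simp [Store.set_apply, H.input, H.out, H.rej, H.entered, H.cur, H.best, H.counter]
  by_cases hw : w' = w
  · simp [hw]
  · simp [hw, Fin.val_inj, H.husb]

theorem set_rej (H : Rep I s i cur best j h R o) (m w : Fin n) :
    Rep I (s.set 3 ((m + 1) * n + (w + 1)) 1) i cur best j h (insert (m, w) R) o := by
  refine ⟨H.bounded.set _ _ (I.bitLength_le_of_le (by simp) (by simp)),
    ?_, ?_, ?_, fun m' w' => ?_, ?_, ?_, ?_, ?_⟩
  case refine_4 =>
    rw [Store.set_apply, H.rej]
    by_cases hmw : m' = m ∧ w' = w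
    · simp [hmw]
    · have hne : ¬ ((m' : ℤ) + 1) * n + (w' + 1) = (m + 1) * n + (w + 1) :=
        fun e => hmw (cell_succ_inj e)
      simp [hne, hmw]
  all_goals
    simp [Store.set_apply, H.input, H.out, H.husb, H.entered, H.cur, H.best, H.counter]

theorem set_out (H : Rep I s i cur best j h R o) (m w : Fin n) :
    Rep I (s.set 1 (m * n + w) 1) i cur best j h R
      (fun m' w' => if m' = m ∧ w' = w then 1 else o m' w') := by
  refine ⟨H.bounded.set _ _ (I.bitLength_le_of_le (by simp) (by simp)),
    ?_, fun m' w' => ?_, ?_, ?_, ?_, ?_, ?_, ?_⟩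
  case refine_2 =>
    rw [Store.set_apply, H.out]
    by_cases hmw : m' = m ∧ w' = w
    · simp [hmw]
    · have hne : ¬ (m' : ℤ) * n + w' = m * n + w := fun e => hmw (cell_inj e)
      simp [hne, hmw]
  all_goals
    simp [Store.set_apply, H.input, H.husb, H.rej, H.entered, H.cur, H.best, H.counter]

theorem entry_val (H : Rep I s i cur best j h R o) {x y : Expr} {m w : Fin n}
    (hx : x.val s = m + 1) (hy : y.val s = w + 1) {r : ℕ} (hr : r < 4) :
    (entry x y r).val s =
      [(I.U m w).num, ((I.U m w).den : ℤ), (I.V m w).num, ((I.V m w).den : ℤ)].getD r 0 := by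
  rw [← I.getD_encode m w hr]
  simp only [entry, Expr.val, Op.val, cell, pred, var, hx, hy, H.size, H.input, RAM.initial]
  have e : (1 + 4 * (((m : ℤ) + 1 - 1) * n + (w + 1 - 1)) + r) =
      ((1 + 4 * ((m : ℕ) * n + w) + r : ℕ) : ℤ) := by
    push_cast
    ring
  simp only [e, Int.toNat_natCast]
  rw [if_pos ⟨trivial, by positivity⟩]

theorem keyLt_man (H : Rep I s i cur best j h R o) {x y x' y' : Expr} {m w m' w' : Fin n}
    (hx : x.val s = m + 1) (hy : y.val s = w + 1) (hx' : x'.val s = m' + 1)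
    (hy' : y'.val s = w' + 1) :
    (keyLt (entry x y) (entry x' y') 0).val s ≠ 0 ↔
      SMC.key (I.U m w) (I.V m w) < SMC.key (I.U m' w') (I.V m' w') :=
  keyLt_val_ne_zero_iff (I.V_nonneg _ _) (I.V_nonneg _ _)
    (H.entry_val hx hy (r := 0) (by omega)) (H.entry_val hx hy (r := 1) (by omega))
    (H.entry_val hx hy (r := 2) (by omega)) (H.entry_val hx hy (r := 3) (by omega))
    (H.entry_val hx' hy' (r := 0) (by omega)) (H.entry_val hx' hy' (r := 1) (by omega))
    (H.entry_val hx' hy' (r := 2) (by omega)) (H.entry_val hx' hy' (r := 3) (by omega))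

theorem keyLt_woman (H : Rep I s i cur best j h R o) {x y x' y' : Expr} {m w m' w' : Fin n}
    (hx : x.val s = m + 1) (hy : y.val s = w + 1) (hx' : x'.val s = m' + 1)
    (hy' : y'.val s = w' + 1) :
    (keyLt (entry x y) (entry x' y') 2).val s ≠ 0 ↔
      SMC.key (I.V m w) (I.U m w) < SMC.key (I.V m' w') (I.U m' w') :=
  keyLt_val_ne_zero_iff (I.U_nonneg _ _) (I.U_nonneg _ _)
    (H.entry_val hx hy (r := 2) (by omega)) (H.entry_val hx hy (r := 3) (by omega))
    (H.entry_val hx hy (r := 0) (by omega)) (H.entry_val hx hy (r := 1) (by omega))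
    (H.entry_val hx' hy' (r := 2) (by omega)) (H.entry_val hx' hy' (r := 3) (by omega))
    (H.entry_val hx' hy' (r := 0) (by omega)) (H.entry_val hx' hy' (r := 1) (by omega))

end Rep

end DeferredAcceptance

/-! ### Correctness and running time of the program. -/

namespace DeferredAcceptance

open RAM

variable {n : ℕ} {I : SMC n} {s : Store} {i : ℕ} {cur best : Option (Fin n)} {j : ℤ}
    {h : Fin n → Option (Fin n)} {R : Finset (Fin n × Fin n)} {o : Fin n → Fin n → ℤ}

theorem runs_search {m : Fin n} (H : Rep I s i (some m) best j h R o)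
    (hR : ∃ w, (m, w) ∉ R) :
    Runs (inputSize I.encode) search s fun s' => ∃ (b : Fin n) (j' : ℤ),
      Rep I s' i (some m) (some b) j' h R o ∧ (m, b) ∉ R ∧
      ∀ w, (m, w) ∉ R → SMC.key (I.U m w) (I.V m w) ≤ SMC.key (I.U m b) (I.V m b) := by
  refine .seq (.assign H.bounded ?_)
  have H₁ := H.set_best none
  refine .seq (.assign H₁.bounded ?_)
  have H₂ := H₁.set_counter le_rfl (by positivity)
  -- After `c` women have been inspected, `b` is a best one among those who have not rejected `m`,
  -- if any; `k = n - c` remain.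
  refine Runs.loop (P := fun k s => ∃ (c : ℕ) (b : Option (Fin n)), c + k = n ∧
    Rep I s i (some m) b c h R o ∧ (∀ a, b = some a → (m, a) ∉ R) ∧
    ∀ w : Fin n, (w : ℕ) < c → (m, w) ∉ R → ∃ a, b = some a ∧
      SMC.key (I.U m w) (I.V m w) ≤ SMC.key (I.U m a) (I.V m a)) ?_ ?_ ?_
    (k := n) (by nlinarith [I.le_inputSize_encode]) ⟨0, none, by simp, H₂, by simp, by simp⟩
  · rintro k s ⟨c, b, -, H, -⟩
    exact H.bounded
  · rintro k s ⟨c, b, hc, H, hb, hbest⟩ he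
    have hcn : c < n := by
      simpa [Expr.val, Op.val, var, H.size, H.counter] using he
    obtain ⟨w, rfl⟩ : ∃ w : Fin n, (w : ℕ) = c := ⟨⟨c, hcn⟩, rfl⟩
    refine .seq (.assign H.bounded ?_)
    have e : (succ (var 7)).val s = ((w + 1 : ℕ) : ℤ) := by
      simp [succ, var, Expr.val, Op.val, H.counter]
    rw [e]
    replace H := H.set_counter (v := ((w + 1 : ℕ) : ℤ)) (by positivity) (by omega)
    change Rep I (s.set 7 ((Expr.const 0).val s) ((w + 1 : ℕ) : ℤ)) _ _ _ _ _ _ _ at H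
    generalize s.set 7 ((Expr.const 0).val s) ((w + 1 : ℕ) : ℤ) = s at H
    have hcur : (var 5).val s = m + 1 := H.cur
    have hj : (var 7).val s = w + 1 := by simpa [var, Expr.val] using H.counter
    have hlt : ∀ w' : Fin n, (w' : ℕ) < w + 1 → w' = w ∨ (w' : ℕ) < w := fun w' hw' => by
      rw [Fin.ext_iff]
      omega
    have hrej : (Expr.read 3 (cell (var 5) (var 7))).val s = if (m, w) ∈ R then 1 else 0 := by
      rw [← H.rej]
      simp only [cell, Expr.val, Op.val, hcur, hj]
      simp [var, Expr.val, H.size]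
    have done : ∀ {s : Store} {b : Option (Fin n)},
        Rep I s i (some m) b ((w + 1 : ℕ) : ℤ) h R o → (∀ a, b = some a → (m, a) ∉ R) →
        (∀ w' : Fin n, (w' : ℕ) < w + 1 → (m, w') ∉ R → ∃ a, b = some a ∧
          SMC.key (I.U m w') (I.V m w') ≤ SMC.key (I.U m a) (I.V m a)) →
        ∃ k' < k, ∃ (c : ℕ) (b : Option (Fin n)), c + k' = n ∧
          Rep I s i (some m) b c h R o ∧ (∀ a, b = some a → (m, a) ∉ R) ∧
          ∀ w : Fin n, (w : ℕ) < c → (m, w) ∉ R → ∃ a, b = some a ∧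
            SMC.key (I.U m w) (I.V m w) ≤ SMC.key (I.U m a) (I.V m a) :=
      fun H hb hbest => ⟨k - 1, by omega, w + 1, _, by omega, H, hb, hbest⟩
    have hset := H.set_best (some w)
    rw [code_some, ← hj] at hset
    refine .cond H.bounded (fun hne => .skip ?_) fun heq => ?_
    · rw [hrej] at hne
      refine done H hb fun w' hw' hR' => ?_
      rcases hlt w' hw' with rfl | hw'
      · simp [hR'] at hne
      · exact hbest w' hw' hR'
    have hwR : (m, w) ∉ R := by
      intro hc
      simp [hrej, hc] at heq
    refine .cond H.bounded (fun hne => ?_) fun heq => ?_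
    · cases b with
      | none => exact absurd H.best hne
      | some b =>
        have hkey := H.keyLt_man (x := var 5) (y := var 6) (x' := var 5) (y' := var 7)
          hcur H.best hcur hj
        refine .cond H.bounded (fun hne => .assign H.bounded ?_) fun heq => .skip ?_
        · rw [hkey] at hne
          refine done hset (by rintro a ⟨⟩; exact hwR) fun w' hw' hR' => ⟨w, rfl, ?_⟩
          rcases hlt w' hw' with rfl | hw'
          · exact le_rfl
          · obtain ⟨a, ha, hle⟩ := hbest w' hw' hR'
            obtain rfl := Option.some.inj ha
            exact hle.trans hne.le
        · refine done H hb fun w' hw' hR' => ?_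
          rcases hlt w' hw' with rfl | hw'
          · exact ⟨b, rfl, not_lt.1 fun hlt => hkey.2 hlt heq⟩
          · exact hbest w' hw' hR'
    · obtain rfl : b = none := code_inj (H.best.symm.trans heq)
      refine .assign H.bounded (done hset (by rintro a ⟨⟩; exact hwR) fun w' hw' hR' => ?_)
      rcases hlt w' hw' with rfl | hw'
      · exact ⟨w', rfl, le_rfl⟩
      · obtain ⟨a, ha, -⟩ := hbest w' hw' hR'
        cases ha
  · rintro k s ⟨c, b, hc, H, hb, hbest⟩ he
    have hcn : n ≤ c := by
      simpa [Expr.val, Op.val, var, H.size, H.counter] using he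
    -- An available woman exists, so the search has not ended with `none`.
    obtain ⟨w, hw⟩ := hR
    obtain ⟨a, rfl, -⟩ := hbest w (by omega) hw
    refine ⟨a, _, H, hb a rfl, fun w hw => ?_⟩
    obtain ⟨a', ha', hle⟩ := hbest w (by omega) hw
    obtain rfl := Option.some.inj ha'
    exact hle

/-- Each iteration of the main loop decreases this number. -/
def potential (n i : ℕ) (cur : Option (Fin n)) (R : Finset (Fin n × Fin n)) : ℕ :=
  2 * (n - i) + cur.elim 0 (fun _ => 1) + (n * n - R.card)

/-- The invariant of the main loop. -/
def LoopInv (I : SMC n) (k : ℕ) (s : Store) : Prop :=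
  ∃ (i : ℕ) (cur best : Option (Fin n)) (j : ℤ) (h : Fin n → Option (Fin n))
    (R : Finset (Fin n × Fin n)), Rep I s i cur best j h R 0 ∧ i ≤ n ∧
    Inv (fun m w => SMC.key (I.U m w) (I.V m w)) (fun m w => SMC.key (I.V m w) (I.U m w))
      i cur h R ∧ potential n i cur R ≤ k

/-- A new rejection keeps `R.card` at most `n * n`, so the truncated subtraction really drops by
one; the identity of the proposer is irrelevant. -/
theorem potential_insert_lt {m w : Fin n} (hR : (m, w) ∉ R) (c c' : Fin n) :
    potential n i (some c) (insert (m, w) R) < potential n i (some c') R := by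
  have h1 : (insert (m, w) R).card ≤ n * n := by
    simpa using Finset.card_le_univ (insert (m, w) R)
  rw [Finset.card_insert_of_notMem hR] at h1
  simp only [potential, Finset.card_insert_of_notMem hR, Option.elim]
  omega

theorem Rep.val_husb_best {i : ℤ} {w : Fin n} (H : Rep I s i cur (some w) j h R o) :
    (Expr.read 2 (var 6)).val s = code (h w) := by
  have hw : (var 6).val s = w + 1 := H.best
  simp only [Expr.val, hw, H.husb]

theorem runs_propose {m w : Fin n} (H : Rep I s i (some m) (some w) j h R 0) (hi : i ≤ n)
    (hinv : Inv (fun m w => SMC.key (I.U m w) (I.V m w)) (fun m w => SMC.key (I.V m w) (I.U m w))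
      i (some m) h R) (hR : (m, w) ∉ R)
    (hbest : ∀ w', (m, w') ∉ R → SMC.key (I.U m w') (I.V m w') ≤ SMC.key (I.U m w) (I.V m w))
    {k : ℕ} (hk : potential n i (some m) R ≤ k) :
    Runs (inputSize I.encode) propose s fun s' => ∃ k' < k, LoopInv I k' s' := by
  have hcur : (var 5).val s = m + 1 := H.cur
  have hw : (var 6).val s = w + 1 := H.best
  have hh := H.val_husb_best
  refine .cond H.bounded (fun hne => ?_) fun heq => ?_
  · rw [hh] at hne
    obtain ⟨m', hm'⟩ : ∃ m', h w = some m' := by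
      rw [← Option.isSome_iff_exists, Option.isSome_iff_ne_none]
      intro e
      simp [e] at hne
    rw [hm', code_some] at hh
    have hkey := H.keyLt_woman (x := .read 2 (var 6)) (y := var 6) (x' := var 5) (y' := var 6)
      hh hw hcur hw
    refine .cond H.bounded (fun hne => ?_) fun heq => .assign H.bounded ?_
    · rw [hkey] at hne
      refine .seq (.assign H.bounded ?_)
      have e : (cell (.read 2 (var 6)) (var 6)).val s = (m' + 1) * n + (w + 1) := by
        have h0 : (var 0).val s = n := H.size
        simp only [cell, Expr.val, Op.val] at hh ⊢
        rw [hh, hw, h0]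
      rw [e]
      have H₁ := H.set_rej m' w
      have hh₁ := H₁.val_husb_best
      rw [hm', code_some] at hh₁
      -- The counter cell saves the displaced man before the woman's entry is overwritten.
      refine .seq (.assign H₁.bounded ?_)
      change Runs _ _ (Store.set (s.set 3 _ 1) 7 0 _) _
      change Expr.val (s.set 3 _ 1) _ = _ at hh₁
      rw [hh₁]
      have H₂ := H₁.set_counter (v := m' + 1) (by positivity) (by omega)
      generalize (s.set 3 ((m' + 1) * n + (w + 1)) 1).set 7 0 (m' + 1) = s₂ at H₂ ⊢
      refine .seq (.assign H₂.bounded ?_)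
      have hcur₂ : (var 5).val s₂ = m + 1 := H₂.cur
      have hw₂ : (var 6).val s₂ = w + 1 := H₂.best
      rw [hcur₂, hw₂]
      have H₃ := H₂.set_husb w (some m)
      rw [code_some] at H₃
      generalize s₂.set 2 (w + 1) (m + 1) = s₃ at H₃ ⊢
      have hj₃ : (var 7).val s₃ = code (some m') := H₃.counter
      refine .assign H₃.bounded ?_
      rw [hj₃]
      -- A held man has not been rejected by his holder, so the recorded rejection is new.
      exact ⟨_, (potential_insert_lt (hinv.top m' w hm').1 m' m).trans_le hk, i, _, _, _, _, _,
        H₃.set_cur (some m'), hi, hinv.swap hm' hne hR hbest, le_rfl⟩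
    · have e : (cell (var 5) (var 6)).val s = (m + 1) * n + (w + 1) := by
        simp only [cell, Expr.val, Op.val, hcur, hw]
        simp [var, Expr.val, H.size]
      rw [e]
      exact ⟨_, (potential_insert_lt hR m m).trans_le hk, i, _, _, _, _, _, H.set_rej m w, hi,
        hinv.reject hm' (not_lt.1 fun hlt => hkey.2 hlt heq), le_rfl⟩
  · rw [hh] at heq
    have hnone : h w = none := code_inj heq
    refine .seq (.assign H.bounded ?_)
    rw [hw, hcur]
    have H₁ := H.set_husb w (some m)
    refine .assign H₁.bounded ⟨_, lt_of_lt_of_le ?_ hk, i, _, _, _, _, _, H₁.set_cur none, hi,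
      hinv.accept hnone hR hbest, le_rfl⟩
    simp [potential]

theorem runs_enter (H : Rep I s i none best j h R 0) (hi : i < n)
    (hinv : Inv (fun m w => SMC.key (I.U m w) (I.V m w)) (fun m w => SMC.key (I.V m w) (I.U m w))
      i none h R) {k : ℕ} (hk : potential n i none R ≤ k) :
    Runs (inputSize I.encode) enter s fun s' => ∃ k' < k, LoopInv I k' s' := by
  refine .seq (.assign H.bounded ?_)
  have e : (succ (var 4)).val s = ((i + 1 : ℕ) : ℤ) := by
    simp [succ, var, Expr.val, Op.val, H.entered]
  rw [e]
  have H₁ := H.set_entered (v := ((i + 1 : ℕ) : ℤ)) (by positivity) (by omega)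
  refine .assign H₁.bounded ?_
  have H₂ := H₁.set_cur (some ⟨i, hi⟩)
  have e₂ : (var 4).val (s.set 4 0 ((i + 1 : ℕ) : ℤ)) = code (some (⟨i, hi⟩ : Fin n)) := by
    simp [var, Expr.val, Store.set_apply]
  refine ⟨potential n (i + 1) (some ⟨i, hi⟩) R, lt_of_lt_of_le ?_ hk, i + 1, _, _, _, _, _,
    e₂ ▸ H₂, hi, hinv.enter hi, le_rfl⟩
  -- Entering lowers `2 * (n - i)` by two and the new proposer adds one back; hence the factor `2`.
  simp only [potential, Option.elim]
  omega

theorem runs_loop (I : SMC n) :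
    Runs (inputSize I.encode)
      (.loop (.bin .add (.bin .lt (var 4) (var 0)) (var 5))
        (.cond (var 5) (.seq search propose) enter)) (initial I.encode) fun s =>
      ∃ (best : Option (Fin n)) (j : ℤ) (h : Fin n → Option (Fin n))
        (R : Finset (Fin n × Fin n)), Rep I s n none best j h R 0 ∧
        Inv (fun m w => SMC.key (I.U m w) (I.V m w))
          (fun m w => SMC.key (I.V m w) (I.U m w)) n none h R := by
  have hL := I.le_inputSize_encode
  refine Runs.loop (P := LoopInv I) ?_ ?_ ?_ (k := n ^ 2 + 2 * n) (by gcongr)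
    ⟨0, none, none, 0, _, ∅, Rep.initial I, by simp, inv_initial _ _, ?_⟩
  · rintro k s ⟨i, cur, best, j, h, R, H, -⟩
    exact H.bounded
  · rintro k s ⟨i, cur, best, j, h, R, H, hi, hinv, hk⟩ he
    refine .cond H.bounded (fun hne => ?_) fun heq => ?_
    · cases cur with
      | none => exact absurd H.cur hne
      | some m =>
        refine .seq ((runs_search H hinv.exists_not_mem).mono ?_)
        rintro s' ⟨b, j', H', hR, hbest⟩
        exact runs_propose H' hi hinv hR hbest hk
    · obtain rfl : cur = none := code_inj (H.cur.symm.trans heq)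
      refine runs_enter H ?_ hinv hk
      simpa [Expr.val, Op.val, var, H.size, H.cur, H.entered] using he
  · rintro k s ⟨i, cur, best, j, h, R, H, hi, hinv, hk⟩ he
    -- The loop test adds two non-negative numbers, so it vanishes only if all men have entered and
    -- nobody proposes.
    have hc := code_nonneg cur
    simp only [Expr.val, Op.val, var, H.size, H.cur, H.entered] at he
    have hin : ¬ (i : ℤ) < n := by
      intro hlt
      rw [if_pos hlt] at he
      omega
    rw [if_neg hin, zero_add] at he
    obtain rfl : cur = none := code_inj he
    obtain rfl : i = n := by omega
    exact ⟨best, j, h, R, H, hinv⟩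
  · simp [potential, sq, add_comm]

theorem runs_write {σ : Equiv.Perm (Fin n)} (H : Rep I s i cur best j h R 0)
    (hσ : ∀ m, h (σ m) = some m) :
    Runs (inputSize I.encode) write s fun s' =>
      outputMatrix n s' = SMC.permMatching σ := by
  have hσ' : ∀ w, h w = some (σ.symm w) := fun w => by
    conv_lhs => rw [← σ.apply_symm_apply w]
    exact hσ _
  refine .seq (.assign H.bounded ?_)
  have H₁ := H.set_counter le_rfl (by positivity)
  -- The first `c` columns are written; the others still hold their initial zeros, so only the ones
  -- need writing.
  refine Runs.loop (P := fun k s => ∃ (c : ℕ), c + k = n ∧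
    Rep I s i cur best c h R fun m w => if σ m = w ∧ (w : ℕ) < c then 1 else 0) ?_ ?_ ?_
    (k := n) (by nlinarith [I.le_inputSize_encode]) ⟨0, by simp, ?_⟩
  rotate_right
  · have e : (fun m w : Fin n => if σ m = w ∧ (w : ℕ) < 0 then (1 : ℤ) else 0) = 0 := by
      funext m w
      simp
    rw [e]
    exact H₁
  · rintro k s ⟨c, -, H⟩
    exact H.bounded
  · rintro k s ⟨c, hc, H⟩ he
    have hcn : c < n := by
      simpa [Expr.val, Op.val, var, H.size, H.counter] using he
    obtain ⟨w, rfl⟩ : ∃ w : Fin n, (w : ℕ) = c := ⟨⟨c, hcn⟩, rfl⟩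
    refine .seq (.assign H.bounded ?_)
    have e : (succ (var 7)).val s = ((w + 1 : ℕ) : ℤ) := by
      simp [succ, var, Expr.val, Op.val, H.counter]
    rw [e]
    replace H := H.set_counter (v := ((w + 1 : ℕ) : ℤ)) (by positivity) (by omega)
    change Rep I (s.set 7 ((Expr.const 0).val s) ((w + 1 : ℕ) : ℤ)) _ _ _ _ _ _ _ at H
    generalize s.set 7 ((Expr.const 0).val s) ((w + 1 : ℕ) : ℤ) = s at H
    have hj : (var 7).val s = w + 1 := by simpa [var, Expr.val] using H.counter
    refine .assign H.bounded ⟨k - 1, by omega, w + 1, by omega, ?_⟩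
    have e : (cell (pred (.read 2 (var 7))) (pred (var 7))).val s = (σ.symm w : Fin n) * n + w := by
      simp only [cell, pred, Expr.val, Op.val, hj, H.husb, hσ', code_some]
      simp [var, Expr.val, H.size]
    rw [e]
    have eo : (fun m w' : Fin n => if σ m = w' ∧ (w' : ℕ) < w + 1 then (1 : ℤ) else 0) =
        fun m w' => if m = σ.symm w ∧ w' = w then 1 else
          if σ m = w' ∧ (w' : ℕ) < w then 1 else 0 := by
      funext m w'
      have : m = σ.symm w ↔ σ m = w := Equiv.eq_symm_apply σ
      have : w' = w ↔ (w' : ℕ) = w := Fin.ext_iff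
      grind
    rw [eo]
    exact H.set_out (σ.symm w) w
  · rintro k s ⟨c, hc, H⟩ he
    have hcn : n ≤ c := by
      simpa [Expr.val, Op.val, var, H.size, H.counter] using he
    funext m w
    have hwc : (w : ℕ) < c := by omega
    simp [outputMatrix, H.out, SMC.permMatching, hwc]

theorem runs_program (I : SMC n) :
    Runs (inputSize I.encode) program (initial I.encode) fun s =>
      ∃ σ : Equiv.Perm (Fin n), I.IsKeyStable σ ∧ outputMatrix n s = SMC.permMatching σ := by
  refine .seq ((runs_loop I).mono ?_)
  rintro s ⟨best, j, h, R, H, hinv⟩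
  obtain ⟨σ, hσ, hstable⟩ := hinv.exists_matching le_rfl
  exact (runs_write H hσ).mono fun s' hs' => ⟨σ, hstable, hs'⟩

end DeferredAcceptance

theorem mainTheorem3 :
    ∃ (algorithm : RAM.Prog) (bound : Polynomial ℕ), ∀ (n : ℕ) (I : SMC n),
      ∃ (s : RAM.Store) (t : ℕ) (μ : Fin n → Fin n → ℝ),
        RAM.Exec algorithm (RAM.initial I.encode) s t ∧
        t ≤ bound.eval (RAM.inputSize I.encode) ∧
        μ = RAM.outputMatrix n s ∧
        IsFractionalMatching μ ∧ IsCompleteMatching μ ∧ IsIntegralMatching μ ∧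
        I.IsStable μ ∧
        ∀ μopt : Fin n → Fin n → ℝ, I.IsOptimal μopt →
          (∀ α : ℚ, I.IsTernary α →
            I.welfare μ ≥ min (1 / 2) (1 / (α : ℝ)) * I.welfare μopt) ∧
          (∀ σmax σmin : ℚ, IsGreatest I.nonzeroValuations σmax →
            IsLeast I.nonzeroValuations σmin →
            I.welfare μ ≥ (1 + (σmax : ℝ) / (σmin : ℝ))⁻¹ * I.welfare μopt) := by
  refine ⟨DeferredAcceptance.program, DeferredAcceptance.program.bound, fun n I => ?_⟩
  obtain ⟨s, t, hexec, ht, σ, hσ, hs⟩ := DeferredAcceptance.runs_program I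
  refine ⟨s, t, SMC.permMatching σ, hexec, ht, hs.symm,
    SMC.isFractionalMatching_permMatching σ, SMC.isCompleteMatching_permMatching σ,
    SMC.isIntegralMatching_permMatching σ, hσ.isStable, fun μopt hopt => ⟨fun α hα => ?_,
      fun σmax σmin hmax hmin => ?_⟩⟩
  · exact hσ.welfare_ge_of_isTernary hα hopt.1
  · exact hσ.welfare_ge hmax hmin hopt.1
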